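/- Let $d \ge 1$ be an integer and let $S \subseteq \mathbb{R}^d$ be an arbitrary set. A set $L \subseteq \mathbb{R}^d$ is called $S$-free if $L$ is closed and convex and the interior of $L$ is disjoint from $S$; an $S$-free set is called maximal $S$-free if no $S$-free set properly contains it. Define $f(S) \in \{-\infty\} \cup \{0,1,2,\ldots\} \cup \{+\infty\}$ as follows. If there are no $d$-dimensional maximal $S$-free sets, then $f(S) := -\infty$. Otherwise, $f(S)$ is the least integer $k \ge 0$ such that every $d$-dimensional maximal $S$-free set is a polyhedron with at most $k$ facets, and $f(S) := +\infty$ if no such $k$ exists. A set $A \subseteq \mathbb{R}^d$ is called $S$-convex if $A = S \cap C$ for some convex set $C \subseteq \mathbb{R}^d$. Let $h(S)$ be the Helly number of the family of all $S$-convex sets, where the Helly number $h(\mathcal{F}) \in \{0,1,2,\ldots\} \cup \{+\infty\}$ of a nonempty family $\mathcal{F}$ of sets is defined as follows: $h(\{\emptyset\}) := 0$; if $\mathcal{F} \ne \{\emptyset\}$, then $h(\mathcal{F})$ is the least integer $k \ge 1$ such that for all $m \ge 1$ and all $F_1,\ldots,F_m \in \mathcal{F}$ with $F_1 \cap \cdots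 \cap F_m = \emptyset$ there are (not necessarily distinct) indices $i_1,\ldots,i_k \in \{1,\ldots,m\}$ with $F_{i_1} \cap \cdots \cap F_{i_k} = \emptyset$, and $h(\mathcal{F}) := +\infty$ if no such $k$ exists. Then the following statements hold. I. $f(S) \le h(S)$. II. If $S$ is discrete, in the sense that every bounded subset of $S$ is finite, then $f(S) = h(S)$. -/

import Mathlib

open scoped RealInnerProductSpace

noncomputable section

namespace SFree

variable {d : ℕ}

/-- `L` is `S`-free: closed, convex, and its interior is disjoint from `S`. -/
def IsSFree (S L : Set (EuclideanSpace ℝ (Fin d))) : Prop :=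
  IsClosed L ∧ Convex ℝ L ∧ Disjoint (interior L) S

/-- `L` is maximal `S`-free: an inclusion-maximal `S`-free set. -/
def IsMaximalSFree (S L : Set (EuclideanSpace ℝ (Fin d))) : Prop :=
  Maximal (IsSFree S) L

/-- `L` is `d`-dimensional: its affine hull is the whole space `ℝ^d`. -/
def IsFullDimensional (L : Set (EuclideanSpace ℝ (Fin d))) : Prop :=
  affineSpan ℝ L = ⊤

/-- A polyhedron: the solution set of a finite (possibly empty) system of linear inequalities. -/
def IsPolyhedron (P : Set (EuclideanSpace ℝ (Fin d))) : Prop :=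
  ∃ (m : ℕ) (u : Fin m → EuclideanSpace ℝ (Fin d)) (β : Fin m → ℝ),
    P = {x | ∀ i, ⟪u i, x⟫ ≤ β i}

/-- `F` is a facet of the polyhedron `P`: a nonempty face of `P` (the set of maximizers over `P`
of a linear functional) of dimension `dim P - 1`. -/
def IsFacet (P F : Set (EuclideanSpace ℝ (Fin d))) : Prop :=
  F.Nonempty ∧ IsExposed ℝ P F ∧
    Module.finrank ℝ (vectorSpan ℝ F) + 1 = Module.finrank ℝ (vectorSpan ℝ P)

/-- The number of facets of `P`. -/
def numFacets (P : Set (EuclideanSpace ℝ (Fin d))) : ℕ∞ :=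
  {F | IsFacet P F}.encard

/-- Every `d`-dimensional maximal `S`-free set is a polyhedron with at most `k` facets. -/
def IsFacetBound (S : Set (EuclideanSpace ℝ (Fin d))) (k : ℕ) : Prop :=
  ∀ L, IsMaximalSFree S L → IsFullDimensional L → IsPolyhedron L ∧ numFacets L ≤ k

open scoped Classical in
/-- The facet complexity `f(S)`, with values in `{-∞} ∪ {0, 1, 2, …} ∪ {+∞}`: `-∞` if there are no
`d`-dimensional maximal `S`-free sets, and otherwise the least `k` that is a facet bound, or `+∞`
(the infimum of the empty set) if there is no facet bound. -/
def facetComplexity (S : Set (EuclideanSpace ℝ (Fin d))) : WithBot ℕ∞ :=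
  if ∃ L, IsMaximalSFree S L ∧ IsFullDimensional L then
    ((⨅ (k : ℕ) (_ : IsFacetBound S k), (k : ℕ∞) : ℕ∞) : WithBot ℕ∞)
  else ⊥

/-- Among any `m ≥ 1` members of `𝓕` with empty intersection one finds `k` (repetitions allowed)
with empty intersection. -/
def HasHellyProperty {α : Type*} (𝓕 : Set (Set α)) (k : ℕ) : Prop :=
  ∀ m : ℕ, 1 ≤ m → ∀ A : Fin m → Set α, (∀ i, A i ∈ 𝓕) → ⋂ i, A i = ∅ →
    ∃ j : Fin k → Fin m, ⋂ i, A (j i) = ∅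

open scoped Classical in
/-- The Helly number of a nonempty family of sets: `0` for the family `{∅}`, and otherwise the least
`k ≥ 1` with the Helly property, or `+∞` if there is none. -/
def familyHellyNumber {α : Type*} (𝓕 : Set (Set α)) : ℕ∞ :=
  if 𝓕 = {∅} then 0
  else ⨅ (k : ℕ) (_ : 1 ≤ k ∧ HasHellyProperty 𝓕 k), (k : ℕ∞)

/-- `A` is `S`-convex: the intersection of `S` with a convex set. -/
def IsSConvex (S A : Set (EuclideanSpace ℝ (Fin d))) : Prop :=
  ∃ C : Set (EuclideanSpace ℝ (Fin d)), Convex ℝ C ∧ A = S ∩ C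

/-- `h(S)`: the Helly number of the family of all `S`-convex sets. -/
def hellyNumber (S : Set (EuclideanSpace ℝ (Fin d))) : ℕ∞ :=
  familyHellyNumber {A | IsSConvex S A}

/-- `S` is discrete in the sense that every bounded subset of `S` is finite. -/
def IsDiscreteSet (S : Set (EuclideanSpace ℝ (Fin d))) : Prop :=
  ∀ B, B ⊆ S → Bornology.IsBounded B → B.Finite

end SFree

end

open scoped RealInnerProductSpace

namespace SFree

/-! ### Separation by half-spaces -/

section Polyhedra

variable {E : Type*} [NormedAddCommGroup E] [InnerProductSpace ℝ E] [FiniteDimensional ℝ E]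

/-! For `f ≤ h`, let `k` be a Helly bound and `L` a full-dimensional maximal `S`-free set. Finitely
many points of `interior L` span a polytope, and finitely many open half-spaces fit between it and
`interior L`. Their traces on `S` have empty intersection, so `k` of them already miss `S`.
Normalised `k`-tuples form a compact set, so one tuple serves all of `L`
(`HasHellyProperty.exists_halfspaces_of_isSFree`). The polyhedron it defines is `S`-free and
contains `L`, hence equals `L`; each facet uses up one inequality.

For `h ≤ f` with `S` discrete, failure of the Helly property for `k` gives a critical family of more
than `k` convex sets. Minimising the number of points of `S` involved turns it into as many points
of `S` in strictly convex position whose hull contains no other point of `S`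
(`IsCritical.exists_points`). Thicken the hull slightly, cut it by supporting half-spaces at these
points, and extend to a maximal `S`-free set. The points cannot become interior, so each lies on a
facet of its own. -/

lemma exists_finset_bounding_normals (E : Type*) [NormedAddCommGroup E] [InnerProductSpace ℝ E]
    [FiniteDimensional ℝ E] :
    ∃ N : Finset E, (∀ u ∈ N, ‖u‖ = 1) ∧
      ∀ (M : ℝ), 0 ≤ M → ∀ x : E, (∀ u ∈ N, ⟪u, x⟫ < M) → ‖x‖ ≤ 2 * M := by
  -- A finite net of the sphere: every unit vector has inner product above 1/2 with some member.
  obtain ⟨t, ht, hcov⟩ := (isCompact_sphere (0 : E) 1).elim_nhds_subcover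
    (fun u => {v | 1 / 2 < ⟪u, v⟫}) (fun u hu => by
      refine (isOpen_lt continuous_const (by fun_prop)).mem_nhds ?_
      have : ‖u‖ = 1 := by simpa using hu
      simp only [Set.mem_ofPred_eq, real_inner_self_eq_norm_sq, this]
      norm_num)
  refine ⟨t, fun u hu => by simpa using ht u hu, fun M hM x hx => ?_⟩
  rcases eq_or_ne x 0 with rfl | h0
  · simpa using hM
  have hn : 0 < ‖x‖ := norm_pos_iff.2 h0
  have hv : ‖x‖⁻¹ • x ∈ Metric.sphere (0 : E) 1 := by
    simp [norm_smul, hn.ne']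
  obtain ⟨u, hu, huv⟩ := Set.mem_iUnion₂.1 (hcov hv)
  have h1 : 1 / 2 < ‖x‖⁻¹ * ⟪u, x⟫ := by simpa [inner_smul_right] using huv
  have h2 := hx u hu
  rw [inv_mul_eq_div, lt_div_iff₀ hn] at h1
  linarith

/-- A finite system of strict linear inequalities fits between a compact convex set and an open
neighbourhood of it. -/
lemma exists_finset_halfspaces_between {G U : Set E} (hG : IsCompact G) (hGc : Convex ℝ G)
    (hU : IsOpen U) (hGU : G ⊆ U) :
    ∃ N : Finset (E × ℝ), (∀ p ∈ N, ∀ x ∈ G, ⟪p.1, x⟫ < p.2) ∧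
      ∀ y, (∀ p ∈ N, ⟪p.1, y⟫ < p.2) → y ∈ U := by
  classical
  obtain ⟨N₁, hN₁, hbd⟩ := exists_finset_bounding_normals E
  obtain ⟨R, hR0, hR⟩ := hG.isBounded.exists_pos_norm_lt
  -- The normals in `N₁` with bound `R` confine solutions to the ball of radius `2 * R`. What lies
  -- there outside `U` is compact, so finitely many separating half-spaces exclude it.
  have hcpt : IsCompact (Metric.closedBall (0 : E) (2 * R) \ U) :=
    (isCompact_closedBall _ _).diff hU
  obtain ⟨t, ht⟩ := hcpt.elim_finite_subcover
    (fun p : {p : E × ℝ // ∀ x ∈ G, ⟪p.1, x⟫ < p.2} => {y | p.1.2 < ⟪p.1.1, y⟫})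
    (fun p => isOpen_lt continuous_const (by fun_prop))
    (fun y hy => by
      obtain ⟨f, c, hf, hc⟩ := geometric_hahn_banach_closed_point hGc hG.isClosed
        (fun h => hy.2 (hGU h))
      refine Set.mem_iUnion.2 ⟨⟨((InnerProductSpace.toDual ℝ E).symm f, c), fun x hx => ?_⟩, ?_⟩
      · simpa using hf x hx
      · simpa using hc)
  refine ⟨t.image Subtype.val ∪ N₁.image (fun u => (u, R)), ?_, ?_⟩
  · intro p hp x hx
    rcases Finset.mem_union.1 hp with hp | hp
    · obtain ⟨q, -, rfl⟩ := Finset.mem_image.1 hp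
      exact q.2 x hx
    · obtain ⟨u, hu, rfl⟩ := Finset.mem_image.1 hp
      calc ⟪u, x⟫ ≤ ‖u‖ * ‖x‖ := real_inner_le_norm _ _
        _ < R := by rw [hN₁ u hu, one_mul]; exact hR x hx
  · intro y hy
    have hyR : ‖y‖ ≤ 2 * R := hbd R hR0.le y fun u hu =>
      hy (u, R) (Finset.mem_union_right _ (Finset.mem_image_of_mem _ hu))
    by_contra hyU
    obtain ⟨p, hp, hpy⟩ := Set.mem_iUnion₂.1 (ht ⟨by simpa using hyR, hyU⟩)
    exact lt_asymm hpy (hy p.1 (Finset.mem_union_left _ (Finset.mem_image_of_mem _ hp)))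

omit [FiniteDimensional ℝ E] in
lemma isOpen_setOf_forall_inner_lt {ι : Type*} [Finite ι] (u : ι → E) (β : ι → ℝ) :
    IsOpen {x | ∀ i, ⟪u i, x⟫ < β i} := by
  simp only [Set.ofPred_forall]
  exact isOpen_iInter_of_finite fun i => isOpen_lt (by fun_prop) continuous_const

omit [FiniteDimensional ℝ E] in
lemma inner_lt_of_mem_interior {u : E} (hu : u ≠ 0) {β : ℝ} {s : Set E}
    (hs : ∀ x ∈ s, ⟪u, x⟫ ≤ β) {x : E} (hx : x ∈ interior s) : ⟪u, x⟫ < β := by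
  have hc : Continuous fun t : ℝ => x + t • u := by fun_prop
  have h : ∀ᶠ t in nhds (0 : ℝ), x + t • u ∈ s :=
    hc.continuousAt.eventually_mem (by simpa using mem_interior_iff_mem_nhds.1 hx)
  obtain ⟨ε, hε, hball⟩ := Metric.eventually_nhds_iff.1 h
  have h1 := hs _ (hball (y := ε / 2) (by simp [abs_of_pos hε, hε]))
  rw [inner_add_right, inner_smul_right, real_inner_self_eq_norm_sq] at h1
  have : 0 < ‖u‖ := norm_pos_iff.2 hu
  nlinarith [mul_pos (half_pos hε) (pow_pos this 2)]

lemma finrank_orthogonal_singleton_add_one {u : E} (hu : u ≠ 0) :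
    Module.finrank ℝ (ℝ ∙ u)ᗮ + 1 = Module.finrank ℝ E := by
  have := Submodule.finrank_add_finrank_orthogonal (ℝ ∙ u)
  rw [finrank_span_singleton hu] at this
  omega

omit [FiniteDimensional ℝ E] in
lemma vectorSpan_le_orthogonal {u : E} {β : ℝ} {F : Set E} (hF : ∀ x ∈ F, ⟪u, x⟫ = β) :
    vectorSpan ℝ F ≤ (ℝ ∙ u)ᗮ := by
  refine Submodule.span_le.2 ?_
  rintro _ ⟨x, hx, y, hy, rfl⟩
  simp only [SetLike.mem_coe, Submodule.mem_orthogonal_singleton_iff_inner_right, vsub_eq_sub,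
    inner_sub_right, hF x hx, hF y hy, sub_self]

end Polyhedra

/-! ### Counting the facets of a polyhedron -/

variable {d : ℕ}

local notation "𝔼" => EuclideanSpace ℝ (Fin d)

/-- A facet of a full-dimensional polyhedron is cut out by one of the defining inequalities. -/
lemma IsFacet.exists_eq_inter {ι : Type*} [Fintype ι] {u : ι → 𝔼} {β : ι → ℝ} (hu : ∀ i, u i ≠ 0)
    {P F : Set 𝔼} (hP : P = {x | ∀ i, ⟪u i, x⟫ ≤ β i}) (hdim : vectorSpan ℝ P = ⊤)
    (hF : IsFacet P F) : ∃ i, F = P ∩ {x | ⟪u i, x⟫ = β i} := by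
  classical
  obtain ⟨⟨y₀, hy₀⟩, hexp, hrank⟩ := hF
  obtain ⟨l, hl⟩ := hexp ⟨y₀, hy₀⟩
  have hFP : F ⊆ P := hexp.subset
  have hrank' : Module.finrank ℝ (vectorSpan ℝ F) + 1 = Module.finrank ℝ 𝔼 := by
    rw [hrank, hdim, finrank_top]
  have hPc : Convex ℝ P := by
    rw [hP, Set.ofPred_forall]
    exact convex_iInter fun i => convex_halfSpace_le (innerₗ 𝔼 (u i)).isLinear _
  have hFc : Convex ℝ F := hexp.convex hPc
  -- Otherwise averaging yields a point of `F` strict in every inequality, hence interior to `P`.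
  -- There `l` has a local maximum, so `l = 0` and `F = P`, against the dimension.
  have hact : ∃ i, ∀ y ∈ F, ⟪u i, y⟫ = β i := by
    by_contra! hcon
    choose y hyF hy using hcon
    have hstrict : ∀ J : Finset ι, ∃ z ∈ F, ∀ i ∈ J, ⟪u i, z⟫ < β i := by
      intro J
      induction J using Finset.induction_on with
      | empty => exact ⟨y₀, hy₀, by simp⟩
      | insert a J _ ih =>
        obtain ⟨z, hz, hzJ⟩ := ih
        refine ⟨(1 / 2 : ℝ) • z + (1 / 2 : ℝ) • y a,
          hFc hz (hyF a) (by norm_num) (by norm_num) (by norm_num), fun i hi => ?_⟩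
        have hle : ∀ x ∈ F, ⟪u i, x⟫ ≤ β i := fun x hx => by
          have := hFP hx
          rw [hP] at this
          exact this i
        rw [inner_add_right, inner_smul_right, inner_smul_right]
        rcases Finset.mem_insert.1 hi with rfl | hi
        · have := lt_of_le_of_ne (hle _ (hyF i)) (hy i)
          linarith [hle z hz]
        · linarith [hle _ (hyF a), hzJ i hi]
    obtain ⟨z, hzF, hz⟩ := hstrict Finset.univ
    have hnhds : P ∈ nhds z := by
      refine Filter.mem_of_superset ((isOpen_setOf_forall_inner_lt u β).mem_nhds
        (fun i => hz i (Finset.mem_univ i))) ?_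
      rw [hP]
      exact fun x hx i => (hx i).le
    have hmax : IsLocalMax l z := by
      rw [hl] at hzF
      filter_upwards [hnhds] with x hx using hzF.2 x hx
    have hl0 : l = 0 := hmax.hasFDerivAt_eq_zero l.hasFDerivAt
    have : F = P := by rw [hl]; ext; simp [hl0]
    rw [this] at hrank
    omega
  obtain ⟨i, hi⟩ := hact
  refine ⟨i, Set.Subset.antisymm (fun x hx => ⟨hFP hx, hi x hx⟩) ?_⟩
  rintro x ⟨hxP, hx⟩
  have hspan : vectorSpan ℝ F = (ℝ ∙ u i)ᗮ :=
    Submodule.eq_of_le_of_finrank_eq (vectorSpan_le_orthogonal hi) (by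
      have := finrank_orthogonal_singleton_add_one (hu i)
      omega)
  -- `l` is constant on `F`, hence on the whole hyperplane that `F` spans.
  have hker : vectorSpan ℝ F ≤ LinearMap.ker (l : 𝔼 →ₗ[ℝ] ℝ) := by
    refine Submodule.span_le.2 ?_
    rintro _ ⟨a, ha, b, hb, rfl⟩
    rw [hl] at ha hb
    have := le_antisymm (hb.2 a ha.1) (ha.2 b hb.1)
    simp [this]
  have hxl : x - y₀ ∈ vectorSpan ℝ F := by
    rw [hspan, Submodule.mem_orthogonal_singleton_iff_inner_right, inner_sub_right, hi y₀ hy₀]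
    exact sub_eq_zero.2 hx
  have hxl' : l x = l y₀ := by simpa [sub_eq_zero] using hker hxl
  rw [hl] at hy₀ ⊢
  exact ⟨hxP, fun y hy => hxl' ▸ hy₀.2 y hy⟩

lemma numFacets_le_card {ι : Type*} [Fintype ι] {u : ι → 𝔼} {β : ι → ℝ} (hu : ∀ i, u i ≠ 0)
    {P : Set 𝔼} (hP : P = {x | ∀ i, ⟪u i, x⟫ ≤ β i}) (hdim : vectorSpan ℝ P = ⊤) :
    numFacets P ≤ Fintype.card ι := by
  have hsub : {F | IsFacet P F} ⊆ Set.range fun i => P ∩ {x | ⟪u i, x⟫ = β i} := fun F hF => by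
    obtain ⟨i, hi⟩ := hF.exists_eq_inter hu hP hdim
    exact ⟨i, hi.symm⟩
  calc numFacets P ≤ (Set.range fun i => P ∩ {x | ⟪u i, x⟫ = β i}).encard :=
        Set.encard_le_encard hsub
    _ ≤ (Set.univ : Set ι).encard := by
        rw [← Set.image_univ]
        exact Set.encard_image_le _ _
    _ = Fintype.card ι := by simp [Set.encard_univ]

lemma isPolyhedron_of_fintype {ι : Type*} [Fintype ι] (u : ι → 𝔼) (β : ι → ℝ) :
    IsPolyhedron {x | ∀ i, ⟪u i, x⟫ ≤ β i} :=
  ⟨Fintype.card ι, u ∘ (Fintype.equivFin ι).symm, β ∘ (Fintype.equivFin ι).symm, by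
    ext x
    exact ((Fintype.equivFin ι).symm.forall_congr_right (q := fun i => ⟪u i, x⟫ ≤ β i)).symm⟩

/-! ### From the Helly property to a facet bound -/

lemma isSConvex_halfSpace (S : Set 𝔼) (u : 𝔼) (β : ℝ) : IsSConvex S (S ∩ {x | ⟪u, x⟫ < β}) :=
  ⟨_, convex_halfSpace_lt (innerₗ 𝔼 u).isLinear _, rfl⟩

/-- The Helly property turns an open convex set missing `S` into `k` half-spaces which contain
a prescribed compact convex subset and jointly miss `S`. -/
lemma HasHellyProperty.exists_halfspaces {S : Set 𝔼} (hS : S.Nonempty) {k : ℕ}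
    (hk : HasHellyProperty {A | IsSConvex S A} k) {G U : Set 𝔼} (hG : IsCompact G)
    (hGc : Convex ℝ G) (hU : IsOpen U) (hGU : G ⊆ U) (hUS : Disjoint U S) :
    ∃ z : Fin k → 𝔼 × ℝ, (∀ i, ∀ x ∈ G, ⟪(z i).1, x⟫ < (z i).2) ∧
      ∀ s ∈ S, ∃ i, (z i).2 ≤ ⟪(z i).1, s⟫ := by
  obtain ⟨N, hNG, hNU⟩ := exists_finset_halfspaces_between hG hGc hU hGU
  have hN : N.Nonempty := by
    by_contra h
    rw [Finset.not_nonempty_iff_eq_empty] at h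
    obtain ⟨s, hs⟩ := hS
    exact Set.disjoint_left.1 hUS (hNU s (by simp [h])) hs
  let e := N.equivFin
  obtain ⟨j, hj⟩ := hk N.card hN.card_pos
    (fun i => S ∩ {x | ⟪(e.symm i).1.1, x⟫ < (e.symm i).1.2})
    (fun i => isSConvex_halfSpace _ _ _) (by
      refine Set.eq_empty_iff_forall_notMem.2 fun s hs => ?_
      rw [Set.mem_iInter] at hs
      have hsS : s ∈ S := (hs ⟨0, hN.card_pos⟩).1
      refine Set.disjoint_left.1 hUS (hNU s fun p hp => ?_) hsS
      simpa using (hs (e ⟨p, hp⟩)).2)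
  refine ⟨fun i => (e.symm (j i)).1, fun i => hNG _ (e.symm (j i)).2, fun s hs => ?_⟩
  by_contra! hcon
  exact Set.eq_empty_iff_forall_notMem.1 hj s (Set.mem_iInter.2 fun i => ⟨hs, hcon i⟩)

/-- Compactness: each finite set of interior points admits a suitable tuple of norm-one pairs, and
the conditions on the tuple are closed once strict inequalities are relaxed. -/
lemma HasHellyProperty.exists_halfspaces_of_isSFree {S L : Set 𝔼} (hS : S.Nonempty) {k : ℕ}
    (hk : HasHellyProperty {A | IsSConvex S A} k) (hL : IsSFree S L)
    (hint : (interior L).Nonempty) :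
    ∃ z : Fin k → 𝔼 × ℝ, (∀ i, z i ≠ 0) ∧ (∀ i, ∀ x ∈ L, ⟪(z i).1, x⟫ ≤ (z i).2) ∧
      ∀ s ∈ S, ∃ i, (z i).2 ≤ ⟪(z i).1, s⟫ := by
  classical
  obtain ⟨hLcl, hLc, hLS⟩ := hL
  obtain ⟨x₀, hx₀⟩ := hint
  let K : Set (Fin k → 𝔼 × ℝ) := {z | z ∈ Set.pi Set.univ (fun _ => Metric.sphere 0 1) ∧
      ∀ s ∈ S, ∃ i, (z i).2 ≤ ⟪(z i).1, s⟫}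
  have hK : IsCompact K := by
    refine (isCompact_univ_pi fun _ => isCompact_sphere _ _).inter_right ?_
    have : {z : Fin k → 𝔼 × ℝ | ∀ s ∈ S, ∃ i, (z i).2 ≤ ⟪(z i).1, s⟫} =
        ⋂ s ∈ S, ⋃ i, {z | (z i).2 ≤ ⟪(z i).1, s⟫} := by
      ext z
      simp
    change IsClosed {z : Fin k → 𝔼 × ℝ | ∀ s ∈ S, ∃ i, (z i).2 ≤ ⟪(z i).1, s⟫}
    rw [this]
    exact isClosed_biInter fun s _ => isClosed_iUnion_of_finite fun i =>
      isClosed_le (by fun_prop) (by fun_prop)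
  obtain ⟨z, ⟨hz1, hzS⟩, hz⟩ := hK.inter_iInter_nonempty
    (fun x : interior L => {z | ∀ i, ⟪(z i).1, (x : 𝔼)⟫ ≤ (z i).2})
    (fun x => by
      simp only [Set.ofPred_forall]
      exact isClosed_iInter fun i => isClosed_le (by fun_prop) (by fun_prop))
    (fun F => by
      -- Adjoining `x₀` keeps `G` nonempty, which rules out the pair `0` and permits normalisation.
      let G := convexHull ℝ (insert x₀ (Subtype.val '' (F : Set (interior L))))
      have hGL : G ⊆ interior L := convexHull_min
        (Set.insert_subset hx₀ (by rintro _ ⟨x, -, rfl⟩; exact x.2)) hLc.interior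
      obtain ⟨z, hzG, hzS⟩ := hk.exists_halfspaces hS
        (((F.finite_toSet.image _).insert x₀).isCompact_convexHull (𝕜 := ℝ))
        (convex_convexHull ℝ _) isOpen_interior hGL hLS
      have hpos : ∀ i, 0 < ‖z i‖ := fun i => norm_pos_iff.2 fun h0 => by
        have := hzG i x₀ (subset_convexHull ℝ _ (Set.mem_insert _ _))
        simp [h0] at this
      refine ⟨fun i => ‖z i‖⁻¹ • z i, ⟨fun i _ => ?_, fun s hs => ?_⟩, ?_⟩
      · simp [norm_smul, (hpos i).ne']
      · obtain ⟨i, hi⟩ := hzS s hs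
        refine ⟨i, ?_⟩
        simp only [Prod.smul_fst, Prod.smul_snd, real_inner_smul_left, smul_eq_mul]
        exact mul_le_mul_of_nonneg_left hi (inv_nonneg.2 (hpos i).le)
      · refine Set.mem_iInter₂.2 fun x hx i => ?_
        have := hzG i x (subset_convexHull ℝ _ (Set.mem_insert_of_mem _ ⟨x, hx, rfl⟩))
        simp only [Prod.smul_fst, Prod.smul_snd, real_inner_smul_left, smul_eq_mul]
        exact mul_le_mul_of_nonneg_left this.le (inv_nonneg.2 (hpos i).le))
  refine ⟨z, fun i h0 => ?_, fun i x hx => ?_, hzS⟩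
  · have := hz1 i (Set.mem_univ i)
    simp [h0] at this
  · have hsub : interior L ⊆ {x | ⟪(z i).1, x⟫ ≤ (z i).2} := fun y hy =>
      Set.mem_iInter.1 hz ⟨y, hy⟩ i
    have hcl : IsClosed {x | ⟪(z i).1, x⟫ ≤ (z i).2} := isClosed_le (by fun_prop) (by fun_prop)
    refine closure_minimal hsub hcl ?_
    rw [hLc.closure_interior_eq_closure_of_nonempty_interior ⟨x₀, hx₀⟩]
    exact subset_closure hx

lemma IsFullDimensional.interior_nonempty {L : Set 𝔼} (hL : IsFullDimensional L)
    (hc : Convex ℝ L) : (interior L).Nonempty :=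
  hc.interior_nonempty_iff_affineSpan_eq_top.2 hL

lemma IsFullDimensional.vectorSpan_eq_top {L : Set 𝔼} (hL : IsFullDimensional L) :
    vectorSpan ℝ L = ⊤ :=
  AffineSubspace.vectorSpan_eq_top_of_affineSpan_eq_top ℝ 𝔼 𝔼 hL

lemma HasHellyProperty.isFacetBound {S : Set 𝔼} (hS : S.Nonempty) {k : ℕ}
    (hk : HasHellyProperty {A | IsSConvex S A} k) : IsFacetBound S k := by
  classical
  intro L hmax hfull
  have hint := hfull.interior_nonempty hmax.prop.2.1
  obtain ⟨z, hz0, hzL, hzS⟩ := hk.exists_halfspaces_of_isSFree hS hmax.prop hint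
  let ι := {i : Fin k // (z i).1 ≠ 0}
  let Q : Set 𝔼 := {x | ∀ i : ι, ⟪(z i).1, x⟫ ≤ (z i).2}
  have hQcl : IsClosed Q := by
    simp only [Q, Set.ofPred_forall]
    exact isClosed_iInter fun i => isClosed_le (by fun_prop) (by fun_prop)
  have hQc : Convex ℝ Q := by
    simp only [Q, Set.ofPred_forall]
    exact convex_iInter fun i => convex_halfSpace_le (innerₗ 𝔼 (z i).1).isLinear _
  have hLQ : L ⊆ Q := fun x hx i => hzL i x hx
  have hQ : IsSFree S Q := by
    refine ⟨hQcl, hQc, Set.disjoint_left.2 fun s hs hsS => ?_⟩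
    obtain ⟨i, hi⟩ := hzS s hsS
    -- With zero normal, a point of `L` forces a nonnegative bound and `s` a nonpositive one, so the
    -- pair would vanish. Dropping such pairs from `Q` is therefore harmless.
    by_cases hi0 : (z i).1 = 0
    · obtain ⟨x, hx⟩ := hint
      have h1 := hzL i x (interior_subset hx)
      rw [hi0, inner_zero_left] at h1 hi
      exact hz0 i (Prod.ext hi0 (le_antisymm hi h1))
    · exact hi.not_gt (inner_lt_of_mem_interior hi0 (fun x (hx : x ∈ Q) => hx ⟨i, hi0⟩) hs)
  have hLQ' : L = Q := hLQ.antisymm (hmax.le_of_ge hQ hLQ)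
  refine ⟨hLQ' ▸ isPolyhedron_of_fintype (fun i : ι => (z i).1) (fun i => (z i).2), ?_⟩
  refine (numFacets_le_card (fun i : ι => i.2) hLQ' hfull.vectorSpan_eq_top).trans ?_
  exact_mod_cast (Fintype.card_subtype_le _).trans_eq (Fintype.card_fin k)

lemma isMaximalSFree_empty_iff {L : Set 𝔼} : IsMaximalSFree ∅ L ↔ L = Set.univ := by
  have huniv : IsSFree ∅ (Set.univ : Set 𝔼) := ⟨isClosed_univ, convex_univ, by simp⟩
  refine ⟨fun h => Set.univ_subset_iff.1 (h.le_of_ge huniv (Set.subset_univ _)), ?_⟩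
  rintro rfl
  exact ⟨huniv, fun _ _ _ => Set.subset_univ _⟩

/-- Matches the convention that `{∅}` has Helly number 0; the half-space argument needs `S`
nonempty. -/
lemma isFacetBound_empty : IsFacetBound (∅ : Set 𝔼) 0 := by
  intro L hmax hfull
  have hL : L = {x | ∀ i : Fin 0, ⟪(0 : 𝔼), x⟫ ≤ (0 : ℝ)} := by
    simp [isMaximalSFree_empty_iff.1 hmax]
  refine ⟨⟨0, fun _ => 0, fun _ => 0, hL⟩, ?_⟩
  exact (numFacets_le_card (u := fun _ : Fin 0 => (0 : 𝔼)) (fun i => i.elim0) hL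
    hfull.vectorSpan_eq_top).trans_eq (by simp)

lemma setOf_isSConvex_eq_singleton_empty_iff {S : Set 𝔼} :
    {A | IsSConvex S A} = {∅} ↔ S = ∅ := by
  refine ⟨fun h => ?_, ?_⟩
  · have : S ∈ ({∅} : Set (Set 𝔼)) := h ▸ ⟨Set.univ, convex_univ, by simp⟩
    exact this
  · rintro rfl
    ext A
    exact ⟨fun ⟨C, _, hA⟩ => by simpa using hA, fun hA => ⟨∅, convex_empty, by simpa using hA⟩⟩

theorem facetComplexity_le_hellyNumber (S : Set 𝔼) :
    facetComplexity S ≤ (hellyNumber S : WithBot ℕ∞) := by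
  unfold facetComplexity
  split_ifs with hex
  swap
  · exact bot_le
  rw [WithBot.coe_le_coe]
  unfold hellyNumber familyHellyNumber
  split_ifs with h
  · rw [setOf_isSConvex_eq_singleton_empty_iff] at h
    subst h
    exact iInf₂_le 0 isFacetBound_empty
  · rw [setOf_isSConvex_eq_singleton_empty_iff, ← ne_eq, ← Set.nonempty_iff_ne_empty] at h
    exact le_iInf₂ fun k hk => iInf₂_le k (hk.2.isFacetBound h)

/-! ### Critical families and points in strictly convex position -/

section Critical

variable {E : Type*} [NormedAddCommGroup E] [InnerProductSpace ℝ E]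

lemma exists_ne_zero_forall_inner_lt [FiniteDimensional ℝ E] [Nontrivial E] {Y : Set E}
    (hY : Y.Finite) {x : E} (hx : x ∉ convexHull ℝ Y) :
    ∃ u : E, u ≠ 0 ∧ ∀ y ∈ Y, ⟪u, y⟫ < ⟪u, x⟫ := by
  rcases Y.eq_empty_or_nonempty with rfl | ⟨y, hy⟩
  · obtain ⟨u, hu⟩ := exists_ne (0 : E)
    exact ⟨u, hu, by simp⟩
  obtain ⟨f, c, hf, hc⟩ := geometric_hahn_banach_closed_point (convex_convexHull ℝ Y)
    (hY.isCompact_convexHull (𝕜 := ℝ)).isClosed hx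
  have h : ∀ y ∈ Y, ⟪(InnerProductSpace.toDual ℝ E).symm f, y⟫ <
      ⟪(InnerProductSpace.toDual ℝ E).symm f, x⟫ := fun y hy => by
    simpa using (hf y (subset_convexHull ℝ Y hy)).trans hc
  refine ⟨_, fun h0 => ?_, h⟩
  have := h y hy
  simp [h0] at this

lemma convexHull_insert_subset_insert_halfSpace {Y : Set E} {u x : E}
    (h : ∀ y ∈ Y, ⟪u, y⟫ < ⟪u, x⟫) :
    convexHull ℝ (insert x Y) ⊆ insert x {y | ⟪u, y⟫ < ⟪u, x⟫} := by
  refine convexHull_min (Set.insert_subset_insert h) ?_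
  intro y hy z hz a b ha hb hab
  have hle : ∀ w ∈ insert x {y | ⟪u, y⟫ < ⟪u, x⟫}, ⟪u, w⟫ ≤ ⟪u, x⟫ := by
    rintro w (rfl | hw)
    exacts [le_rfl, le_of_lt hw]
  rcases ha.eq_or_lt with rfl | ha
  · obtain rfl : b = 1 := by linarith
    simpa using hz
  rcases hb.eq_or_lt with rfl | hb
  · obtain rfl : a = 1 := by linarith
    simpa using hy
  have key : ⟪u, a • y + b • z⟫ = a * ⟪u, y⟫ + b * ⟪u, z⟫ := by
    rw [inner_add_right, inner_smul_right, inner_smul_right]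
  have hx : ⟪u, x⟫ = a * ⟪u, x⟫ + b * ⟪u, x⟫ := by rw [← add_mul, hab, one_mul]
  have hy' := mul_le_mul_of_nonneg_left (hle y hy) ha.le
  have hz' := mul_le_mul_of_nonneg_left (hle z hz) hb.le
  rcases hy with rfl | hy
  · rcases hz with rfl | hz
    · left
      rw [← add_smul, hab, one_smul]
    · right
      have := mul_lt_mul_of_pos_left hz hb
      change ⟪u, _⟫ < ⟪u, _⟫
      linarith
  · right
    have := mul_lt_mul_of_pos_left hy ha
    change ⟪u, _⟫ < ⟪u, _⟫
    linarith

variable {ι : Type*}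

/-- Convex sets whose traces on `T` have no common point, while all but any one of them do. -/
structure IsCritical (T : Set E) (C : ι → Set E) : Prop where
  convex : ∀ i, Convex ℝ (C i)
  notMem : ∀ y ∈ T, ∃ i, y ∉ C i
  exists_mem : ∀ i, ∃ y ∈ T, ∀ j, j ≠ i → y ∈ C j

/-- A critical family of minimal trace yields points of `S` in strictly convex position whose
convex hull contains no further point of `S`. -/
lemma IsCritical.exists_points [FiniteDimensional ℝ E] [Nontrivial E] [Fintype ι]
    {S : Set E} (hS : ∀ B ⊆ S, Bornology.IsBounded B → B.Finite) {C : ι → Set E}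
    (hC : IsCritical S C) :
    ∃ x u : ι → E, (∀ i, x i ∈ S) ∧ (∀ i, u i ≠ 0) ∧
      (∀ i j, j ≠ i → ⟪u i, x j⟫ < ⟪u i, x i⟫) ∧ S ∩ convexHull ℝ (Set.range x) ⊆ Set.range x := by
  classical
  have hfin : ∀ x : ι → E, (S ∩ convexHull ℝ (Set.range x)).Finite := fun x =>
    hS _ Set.inter_subset_left
      ((isBounded_convexHull.2 (Set.finite_range x).isBounded).subset Set.inter_subset_right)
  have hres : ∀ {T : Set E} {C : ι → Set E} {x : ι → E} {T' : Set E}, IsCritical T C → T' ⊆ T →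
      (∀ i, x i ∈ T') → (∀ i j, j ≠ i → x i ∈ C j) → IsCritical T' C :=
    fun h hT hx hxC => ⟨h.convex, fun y hy => h.notMem y (hT hy), fun i => ⟨_, hx i, hxC i⟩⟩
  -- Finiteness of the trace is required explicitly because `ncard` is 0 on infinite sets.
  have hex : ∃ n : ℕ, ∃ D : Set E, Convex ℝ D ∧ (S ∩ D).Finite ∧ (S ∩ D).ncard = n ∧
      ∃ C : ι → Set E, IsCritical (S ∩ D) C := by
    choose x hxS hxC using hC.exists_mem
    exact ⟨_, convexHull ℝ (Set.range x), convex_convexHull ℝ _, hfin x, rfl, C,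
      hres hC Set.inter_subset_left
        (fun i => ⟨hxS i, subset_convexHull ℝ _ ⟨i, rfl⟩⟩) hxC⟩
  obtain ⟨D, hD, hDfin, hDn, C, hC⟩ := Nat.find_spec hex
  have hmin : ∀ D' : Set E, Convex ℝ D' → (S ∩ D').Finite →
      (∃ C' : ι → Set E, IsCritical (S ∩ D') C') → (S ∩ D).ncard ≤ (S ∩ D').ncard :=
    fun D' h1 h2 h3 => hDn ▸ Nat.find_min' hex ⟨D', h1, h2, rfl, h3⟩
  choose x hxT hxC using hC.exists_mem
  have hrange : ∀ i, Set.range x = insert (x i) (x '' {i}ᶜ) := fun i => by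
    rw [← Set.image_insert_eq, ← Set.image_univ]
    congr 1
    ext j
    simp [em]
  -- All other `x j` lie in `C i`; if `x i` were in their hull, it would lie in every member of the
  -- family.
  have hxnot : ∀ i, x i ∉ convexHull ℝ (x '' {i}ᶜ) := fun i hi => by
    have hsub : convexHull ℝ (x '' {i}ᶜ) ⊆ C i := convexHull_min
      (by rintro _ ⟨j, hj, rfl⟩; exact hxC j i (Ne.symm hj)) (hC.convex i)
    obtain ⟨j, hj⟩ := hC.notMem _ (hxT i)
    rcases eq_or_ne j i with rfl | hji
    exacts [hj (hsub hi), hj (hxC i j hji)]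
  choose u hu0 hu using fun i =>
    exists_ne_zero_forall_inner_lt (((Set.toFinite {i}ᶜ).image x)) (hxnot i)
  have hux : ∀ i j, j ≠ i → ⟪u i, x j⟫ < ⟪u i, x i⟫ := fun i j hj => hu i _ ⟨j, hj, rfl⟩
  refine ⟨x, u, fun i => (hxT i).1, hu0, hux, ?_⟩
  set P := convexHull ℝ (Set.range x) with hPdef
  have hPc : Convex ℝ P := convex_convexHull ℝ _
  have hxP : ∀ i, x i ∈ S ∩ P := fun i => ⟨(hxT i).1, subset_convexHull ℝ _ ⟨i, rfl⟩⟩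
  have hPD : P ⊆ D := convexHull_min (by rintro _ ⟨i, rfl⟩; exact (hxT i).2) hD
  have hCP : IsCritical (S ∩ P) C :=
    hres hC (Set.inter_subset_inter_right _ hPD) hxP hxC
  have hPH : ∀ i, ∀ y ∈ P, y ≠ x i → ⟪u i, y⟫ < ⟪u i, x i⟫ := fun i y hy hne => by
    rw [hPdef, hrange i] at hy
    exact (convexHull_insert_subset_insert_halfSpace (hu i) hy).resolve_left hne
  have hcard : (S ∩ D).ncard ≤ (S ∩ P).ncard := hmin P hPc (hfin x) ⟨C, hCP⟩
  -- A second witness `y` could replace `x i`. Cutting `P` with the open half-space below `x i` then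
  -- loses `x i` but stays critical, contradicting minimality.
  have honly : ∀ C' : ι → Set E, IsCritical (S ∩ P) C' → (∀ i j, j ≠ i → x i ∈ C' j) →
      ∀ i, ∀ y ∈ S ∩ P, (∀ j, j ≠ i → y ∈ C' j) → y = x i := by
    intro C' hC' hxC' i y hy hyC'
    by_contra hne
    let H : Set E := {y | ⟪u i, y⟫ < ⟪u i, x i⟫}
    have hsub : S ∩ (P ∩ H) ⊆ S ∩ P := fun z hz => ⟨hz.1, hz.2.1⟩
    have hcrit : IsCritical (S ∩ (P ∩ H)) C' := by
      refine hres (x := Function.update x i y) hC' hsub (fun l => ?_) (fun l j hj => ?_)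
      · rcases eq_or_ne l i with rfl | hl
        · rw [Function.update_self]
          exact ⟨hy.1, hy.2, hPH _ y hy.2 hne⟩
        · rw [Function.update_of_ne hl]
          exact ⟨(hxP l).1, (hxP l).2, hux i l hl⟩
      · rcases eq_or_ne l i with rfl | hl
        · rw [Function.update_self]
          exact hyC' j hj
        · rw [Function.update_of_ne hl]
          exact hxC' l j hj
    have h1 := hmin (P ∩ H)
      (hPc.inter (convex_halfSpace_lt (innerₗ E (u i)).isLinear _)) ((hfin x).subset hsub)
      ⟨C', hcrit⟩
    have h2 : (S ∩ (P ∩ H)).ncard < (S ∩ P).ncard := by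
      refine Set.ncard_lt_ncard (hsub.ssubset_of_mem_notMem (hxP i) fun h => ?_) (hfin x)
      exact lt_irrefl _ (show ⟪u i, x i⟫ < ⟪u i, x i⟫ from h.2.2)
    have h3 : (S ∩ P).ncard ≤ (S ∩ D).ncard :=
      Set.ncard_le_ncard (Set.inter_subset_inter_right _ hPD) hDfin
    omega
  -- Replace the sets by open half-spaces one at a time. By `honly`, only `x a` lies in all sets but
  -- the `a`-th, and the new half-space still omits it.
  have hrepl : ∀ J : Finset ι, ∃ C' : ι → Set E, IsCritical (S ∩ P) C' ∧
      (∀ i j, j ≠ i → x i ∈ C' j) ∧ ∀ i ∈ J, C' i = {y | ⟪u i, y⟫ < ⟪u i, x i⟫} := by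
    intro J
    induction J using Finset.induction_on with
    | empty => exact ⟨C, hCP, hxC, by simp⟩
    | insert a J _ ih =>
      obtain ⟨C', hC', hxC', hJ⟩ := ih
      have hxC'' : ∀ i j, j ≠ i →
          x i ∈ Function.update C' a {y | ⟪u a, y⟫ < ⟪u a, x a⟫} j := by
        intro i j hj
        rcases eq_or_ne j a with rfl | hja
        · rw [Function.update_self]
          exact hux j i hj.symm
        · rw [Function.update_of_ne hja]
          exact hxC' i j hj
      refine ⟨Function.update C' a {y | ⟪u a, y⟫ < ⟪u a, x a⟫}, ⟨fun i => ?_, fun y hy => ?_,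
        fun i => ⟨x i, hxP i, hxC'' i⟩⟩, hxC'', fun i hi => ?_⟩
      · rcases eq_or_ne i a with rfl | hia
        · rw [Function.update_self]
          exact convex_halfSpace_lt (innerₗ E (u i)).isLinear _
        · rw [Function.update_of_ne hia]
          exact hC'.convex i
      · by_contra! hcon
        have hya : y = x a := honly C' hC' hxC' a y hy fun j hj => by
          simpa [Function.update_of_ne hj] using hcon j
        have := hcon a
        rw [Function.update_self, hya] at this
        exact lt_irrefl _ (show ⟪u a, x a⟫ < ⟪u a, x a⟫ from this)
      · rcases eq_or_ne i a with rfl | hia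
        · rw [Function.update_self]
        · rw [Function.update_of_ne hia]
          exact hJ i ((Finset.mem_insert.1 hi).resolve_left hia)
  obtain ⟨C', hC', -, hCH⟩ := hrepl Finset.univ
  intro y hy
  obtain ⟨i, hi⟩ := hC'.notMem y hy
  rw [hCH i (Finset.mem_univ i)] at hi
  by_contra hne
  exact hi (hPH i y hy.2 fun h => hne ⟨i, h.symm⟩)

end Critical

/-! ### Half-balls force facets -/

section HalfBall

variable {E : Type*} [NormedAddCommGroup E] [InnerProductSpace ℝ E]

lemma exists_pos_smul_dist_lt (x v : E) {r : ℝ} (hr : 0 < r) :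
    ∃ t : ℝ, 0 < t ∧ dist (x + t • v) x < r := by
  refine ⟨r / (‖v‖ + 1), by positivity, ?_⟩
  rw [dist_eq_norm, add_sub_cancel_left, norm_smul, Real.norm_of_nonneg (by positivity),
    div_mul_eq_mul_div, div_lt_iff₀ (by positivity)]
  nlinarith [norm_nonneg v]

/-- A convex set containing a half-ball around a non-interior point lies in the half-space. -/
lemma inner_le_of_halfBall_subset {L : Set E} (hLc : Convex ℝ L) (hint : (interior L).Nonempty)
    {x u : E} (hx : x ∉ interior L) {r : ℝ} (hr : 0 < r)
    (hball : ∀ y, dist y x < r → ⟪u, y⟫ ≤ ⟪u, x⟫ → y ∈ L) : ∀ y ∈ L, ⟪u, y⟫ ≤ ⟪u, x⟫ := by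
  intro y hy
  by_contra! hlt
  -- The half-ball makes the separating functional `f` nonpositive wherever `⟪u, ·⟫` is. So `f`
  -- behaves like a nonnegative multiple of `⟪u, ·⟫`, and `f y ≤ f x` clashes with `⟪u, x⟫ < ⟪u,
  -- y⟫`.
  obtain ⟨f, hf⟩ := geometric_hahn_banach_open_point hLc.interior isOpen_interior hx
  have hfL : ∀ z ∈ L, f z ≤ f x := fun z hz => by
    have hcl : IsClosed {z | f z ≤ f x} := isClosed_le (by fun_prop) (by fun_prop)
    refine closure_minimal (fun w hw => (hf w hw).le) hcl ?_
    rw [hLc.closure_interior_eq_closure_of_nonempty_interior hint]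
    exact subset_closure hz
  have hneg : ∀ v, ⟪u, v⟫ ≤ 0 → f v ≤ 0 := fun v hv => by
    obtain ⟨t, ht, htr⟩ := exists_pos_smul_dist_lt x v hr
    have h1 := hfL _ (hball (x + t • v) htr (by
      rw [inner_add_right, inner_smul_right]
      linarith [mul_nonpos_of_nonneg_of_nonpos ht.le hv]))
    rw [map_add, map_smul, smul_eq_mul] at h1
    by_contra! h
    linarith [mul_pos ht h]
  obtain ⟨z, hz⟩ := hint
  have hzx := hf z hz
  have ha : 0 < ⟪u, y - x⟫ := by rw [inner_sub_right]; linarith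
  rcases le_or_gt ⟪u, x - z⟫ 0 with h | h
  · have := hneg _ h
    rw [map_sub] at this
    linarith
  · have h1 := hneg (x - z - (⟪u, x - z⟫ / ⟪u, y - x⟫) • (y - x)) (by
      rw [inner_sub_right, inner_smul_right, div_mul_cancel₀ _ ha.ne', sub_self])
    have h2 : (⟪u, x - z⟫ / ⟪u, y - x⟫) * (f y - f x) ≤ 0 :=
      mul_nonpos_of_nonneg_of_nonpos (div_pos h ha).le (by linarith [hfL y hy])
    rw [map_sub, map_sub, map_smul, map_sub, smul_eq_mul] at h1
    linarith

lemma vectorSpan_eq_orthogonal_of_halfBall_subset {L : Set E} {x u : E} {r : ℝ} (hr : 0 < r)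
    (hball : ∀ y, dist y x < r → ⟪u, y⟫ ≤ ⟪u, x⟫ → y ∈ L) :
    vectorSpan ℝ (L ∩ {y | ⟪u, y⟫ = ⟪u, x⟫}) = (ℝ ∙ u)ᗮ := by
  refine le_antisymm (vectorSpan_le_orthogonal fun y hy => hy.2) fun v hv => ?_
  rw [Submodule.mem_orthogonal_singleton_iff_inner_right] at hv
  obtain ⟨t, ht, htr⟩ := exists_pos_smul_dist_lt x v hr
  have hin : ⟪u, x + t • v⟫ = ⟪u, x⟫ := by
    rw [inner_add_right, inner_smul_right, hv, mul_zero, add_zero]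
  have h := vsub_mem_vectorSpan ℝ
    (show x + t • v ∈ L ∩ {y | ⟪u, y⟫ = ⟪u, x⟫} from ⟨hball _ htr hin.le, hin⟩)
    (show x ∈ L ∩ {y | ⟪u, y⟫ = ⟪u, x⟫} from ⟨hball _ (by simpa using hr) le_rfl, rfl⟩)
  rw [vsub_eq_sub, add_sub_cancel_left] at h
  exact (Submodule.smul_mem_iff _ ht.ne').1 h

end HalfBall

lemma isFacet_of_halfBall_subset {L : Set 𝔼} (hdim : vectorSpan ℝ L = ⊤) {x u : 𝔼} (hu : u ≠ 0)
    (hL : ∀ y ∈ L, ⟪u, y⟫ ≤ ⟪u, x⟫) {r : ℝ} (hr : 0 < r)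
    (hball : ∀ y, dist y x < r → ⟪u, y⟫ ≤ ⟪u, x⟫ → y ∈ L) :
    IsFacet L (L ∩ {y | ⟪u, y⟫ = ⟪u, x⟫}) := by
  have hx : x ∈ L := hball x (by simpa using hr) le_rfl
  refine ⟨⟨x, hx, rfl⟩, fun _ => ⟨innerSL ℝ u, ?_⟩, ?_⟩
  · ext y
    refine ⟨fun hy => ⟨hy.1, fun z hz => ?_⟩, fun hy => ⟨hy.1, ?_⟩⟩
    · simpa [show ⟪u, y⟫ = ⟪u, x⟫ from hy.2] using hL z hz
    · exact le_antisymm (hL y hy.1) (by simpa using hy.2 x hx)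
  · rw [vectorSpan_eq_orthogonal_of_halfBall_subset hr hball,
      finrank_orthogonal_singleton_add_one hu, hdim, finrank_top]

/-! ### Maximal `S`-free sets with many facets -/

lemma IsSFree.exists_isMaximalSFree {S K : Set 𝔼} (hK : IsSFree S K)
    (hint : (interior K).Nonempty) : ∃ L, K ⊆ L ∧ IsMaximalSFree S L := by
  obtain ⟨L, hKL, hL⟩ := zorn_subset_nonempty {L | IsSFree S L ∧ K ⊆ L} (by
    intro c hc hchain hne
    obtain ⟨L₀, hL₀⟩ := hne
    have hconv : Convex ℝ (⋃₀ c) :=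
      hchain.directedOn.convex_sUnion fun A hA => (hc hA).1.2.1
    have hsub : ∀ A ∈ c, A ⊆ closure (⋃₀ c) := fun A hA =>
      (Set.subset_sUnion_of_mem hA).trans subset_closure
    have hKU : K ⊆ ⋃₀ c := (hc hL₀).2.trans (Set.subset_sUnion_of_mem hL₀)
    refine ⟨closure (⋃₀ c), ⟨⟨isClosed_closure, hconv.closure, ?_⟩, hKU.trans subset_closure⟩, hsub⟩
    -- Nonempty interior ensures that closing the convex union does not enlarge its interior.
    rw [hconv.interior_closure_eq_interior_of_nonempty_interior
      (hint.mono (interior_mono hKU)), Set.disjoint_left]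
    intro s hs hsS
    -- Surround `s` by a simplex inside the union; its finitely many vertices lie in one member of
    -- the chain, which then has `s` in its interior.
    obtain ⟨b, hb, hbU⟩ := exists_mem_interior_convexHull_affineBasis
      (mem_interior_iff_mem_nhds.1 hs)
    obtain ⟨A, hA, hbA⟩ := hchain.directedOn.exists_mem_subset_of_finite_of_subset_sUnion
      ⟨L₀, hL₀⟩ (Set.finite_range b) ((subset_convexHull ℝ _).trans hbU)
    have hA' := (hc hA).1
    exact Set.disjoint_left.1 hA'.2.2 (interior_mono (convexHull_min hbA hA'.2.1) hb) hsS)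
    K ⟨hK, subset_rfl⟩
  exact ⟨L, hKL, hL.prop.1, fun M hM hLM => hL.le_of_ge ⟨hM, hKL.trans hLM⟩ hLM⟩

/-- Only finitely many points of `S` outside `P` lie within distance 1, so they keep a positive
distance from `P`. -/
lemma IsDiscreteSet.exists_cthickening_inter_subset {S P : Set 𝔼} (hS : IsDiscreteSet S)
    (hP : IsCompact P) : ∃ δ > 0, S ∩ Metric.cthickening δ P ⊆ P := by
  have hfin : ((S ∩ Metric.cthickening 1 P) \ P).Finite :=
    hS _ (Set.sdiff_subset.trans Set.inter_subset_left)
      (hP.isBounded.cthickening.subset (Set.sdiff_subset.trans Set.inter_subset_right))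
  obtain ⟨δ, hδ, hdisj⟩ := (Set.disjoint_sdiff_right (s := P)).exists_cthickenings hP hfin.isClosed
  refine ⟨min δ 1, lt_min hδ one_pos, fun s hs => ?_⟩
  by_contra hsP
  exact Set.disjoint_left.1 hdisj (Metric.cthickening_mono (min_le_left _ _) _ hs.2)
    (Metric.self_subset_cthickening _
      ⟨⟨hs.1, Metric.cthickening_mono (min_le_right _ _) _ hs.2⟩, hsP⟩)

/-- Points of a discrete set in strictly convex position, with no further point of the set in
their convex hull, lie on different facets of some maximal `S`-free set. -/
lemma IsDiscreteSet.exists_isMaximalSFree_card_le_numFacets {S : Set 𝔼} (hS : IsDiscreteSet S)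
    {ι : Type*} [Fintype ι] [Nonempty ι] {x u : ι → 𝔼} (hxS : ∀ i, x i ∈ S) (hu : ∀ i, u i ≠ 0)
    (hux : ∀ i j, j ≠ i → ⟪u i, x j⟫ < ⟪u i, x i⟫)
    (hconv : S ∩ convexHull ℝ (Set.range x) ⊆ Set.range x) :
    ∃ L, IsMaximalSFree S L ∧ IsFullDimensional L ∧ (Fintype.card ι : ℕ∞) ≤ numFacets L := by
  classical
  obtain ⟨δ, hδ, hδS⟩ := hS.exists_cthickening_inter_subset
    ((Set.finite_range x).isCompact_convexHull (𝕜 := ℝ))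
  let K : Set 𝔼 := Metric.cthickening δ (convexHull ℝ (Set.range x)) ∩
    ⋂ i, {y | ⟪u i, y⟫ ≤ ⟪u i, x i⟫}
  have hxP : ∀ i, x i ∈ convexHull ℝ (Set.range x) := fun i => subset_convexHull ℝ _ ⟨i, rfl⟩
  have hKi : ∀ i, ∀ y ∈ K, ⟪u i, y⟫ ≤ ⟪u i, x i⟫ := fun i y hy => Set.mem_iInter.1 hy.2 i
  have hK : IsSFree S K := by
    refine ⟨Metric.isClosed_cthickening.inter (isClosed_iInter fun i =>
        isClosed_le (by fun_prop) (by fun_prop)),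
      ((convex_convexHull ℝ _).cthickening δ).inter (convex_iInter fun i =>
        convex_halfSpace_le (innerₗ 𝔼 (u i)).isLinear _), Set.disjoint_left.2 fun s hs hsS => ?_⟩
    obtain ⟨i, rfl⟩ := hconv ⟨hsS, hδS ⟨hsS, (interior_subset hs).1⟩⟩
    exact lt_irrefl _ (inner_lt_of_mem_interior (hu i) (hKi i) hs)
  have hball : ∀ i, ∃ r > 0, ∀ y, dist y (x i) < r → ⟪u i, y⟫ ≤ ⟪u i, x i⟫ → y ∈ K := by
    intro i
    have hopen : IsOpen {y : 𝔼 | ∀ j : {j // j ≠ i}, ⟪u j, y⟫ < ⟪u j, x j⟫} :=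
      isOpen_setOf_forall_inner_lt _ _
    -- At `x i` the only active constraint of `K` is the `i`-th, so `K` contains a half-ball there.
    obtain ⟨r, hr, hrs⟩ := Metric.isOpen_iff.1 (Metric.isOpen_thickening.inter hopen) (x i)
      ⟨Metric.self_subset_thickening hδ _ (hxP i), fun j => hux j i j.2.symm⟩
    refine ⟨r, hr, fun y hy hyi => ?_⟩
    obtain ⟨h1, h2⟩ := hrs hy
    refine ⟨Metric.thickening_subset_cthickening _ _ h1, Set.mem_iInter.2 fun j => ?_⟩
    rcases eq_or_ne j i with rfl | hj
    exacts [hyi, (h2 ⟨j, hj⟩).le]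
  choose r hr hball using hball
  have hint : (interior K).Nonempty := by
    obtain ⟨i⟩ := ‹Nonempty ι›
    obtain ⟨t, ht, htr⟩ := exists_pos_smul_dist_lt (x i) (-u i) (hr i)
    have hopen : IsOpen (Metric.ball (x i) (r i) ∩ {y | ⟪u i, y⟫ < ⟪u i, x i⟫}) :=
      Metric.isOpen_ball.inter (isOpen_lt (by fun_prop) (by fun_prop))
    refine ⟨x i + t • -u i, interior_maximal (fun y hy => hball i y hy.1 (le_of_lt hy.2)) hopen
      ⟨htr, ?_⟩⟩
    change ⟪u i, _⟫ < _
    rw [inner_add_right, inner_smul_right, inner_neg_right, real_inner_self_eq_norm_sq]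
    have : 0 < ‖u i‖ := norm_pos_iff.2 (hu i)
    nlinarith [mul_pos ht (pow_pos this 2)]
  obtain ⟨L, hKL, hL⟩ := hK.exists_isMaximalSFree hint
  have hLint : (interior L).Nonempty := hint.mono (interior_mono hKL)
  have hfull : IsFullDimensional L := hL.prop.2.1.interior_nonempty_iff_affineSpan_eq_top.1 hLint
  refine ⟨L, hL, hfull, ?_⟩
  have hballL : ∀ i y, dist y (x i) < r i → ⟪u i, y⟫ ≤ ⟪u i, x i⟫ → y ∈ L :=
    fun i y h1 h2 => hKL (hball i y h1 h2)
  have hfacet : ∀ i, IsFacet L (L ∩ {y | ⟪u i, y⟫ = ⟪u i, x i⟫}) := fun i =>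
    isFacet_of_halfBall_subset hfull.vectorSpan_eq_top (hu i)
      (inner_le_of_halfBall_subset hL.prop.2.1 hLint
        (fun h => Set.disjoint_left.1 hL.prop.2.2 h (hxS i)) (hr i) (hballL i))
      (hr i) (hballL i)
  have hinj : Function.Injective fun i => L ∩ {y | ⟪u i, y⟫ = ⟪u i, x i⟫} := by
    intro i j hij
    by_contra hne
    -- `x j` lies on its own hyperplane but strictly below the `i`-th.
    have hmem : x j ∈ L ∩ {y | ⟪u j, y⟫ = ⟪u j, x j⟫} :=
      ⟨hballL j _ (by simpa using hr j) le_rfl, rfl⟩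
    have : x j ∈ L ∩ {y | ⟪u i, y⟫ = ⟪u i, x i⟫} := by
      rw [show L ∩ {y | ⟪u i, y⟫ = ⟪u i, x i⟫} = L ∩ {y | ⟪u j, y⟫ = ⟪u j, x j⟫} from hij]
      exact hmem
    exact (hux i j (Ne.symm hne)).ne this.2
  calc (Fintype.card ι : ℕ∞) = (Set.univ : Set ι).encard := by simp [Set.encard_univ]
    _ = (Set.range fun i => L ∩ {y | ⟪u i, y⟫ = ⟪u i, x i⟫}).encard := by
      rw [← Set.image_univ, hinj.encard_image]
    _ ≤ numFacets L := Set.encard_le_encard (by rintro _ ⟨i, rfl⟩; exact hfacet i)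

/-- The one-point case of the construction. It forces facet bounds to be at least 1, as the
definition of the Helly number demands of `k`. -/
lemma IsDiscreteSet.exists_isMaximalSFree_of_nonempty (hd : 1 ≤ d) {S : Set 𝔼}
    (hS : IsDiscreteSet S) (hne : S.Nonempty) :
    ∃ L, IsMaximalSFree S L ∧ IsFullDimensional L ∧ 1 ≤ numFacets L := by
  have : Nonempty (Fin d) := ⟨⟨0, hd⟩⟩
  obtain ⟨s, hs⟩ := hne
  obtain ⟨u, hu⟩ := exists_ne (0 : 𝔼)
  simpa using hS.exists_isMaximalSFree_card_le_numFacets (ι := Unit) (x := fun _ => s)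
    (u := fun _ => u) (fun _ => hs) (fun _ => hu) (fun _ _ h => (h rfl).elim) (by simp)

/-! ### From a facet bound to the Helly property -/

/-- A family without the Helly property for `k` contains a critical family of more than `k`
sets. -/
lemma exists_isCritical_of_not_hasHellyProperty {S : Set 𝔼} {k : ℕ} (hk : 1 ≤ k)
    (h : ¬ HasHellyProperty {A | IsSConvex S A} k) :
    ∃ (ι : Type) (_ : Fintype ι) (C : ι → Set 𝔼), k < Fintype.card ι ∧ IsCritical S C := by
  classical
  unfold HasHellyProperty at h
  push Not at h
  obtain ⟨m, -, A, hA, hAe, hj⟩ := h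
  choose C hC hAC using hA
  obtain ⟨I, hI, hImin⟩ := exists_minimal_of_wellFoundedLT
    (fun I : Finset (Fin m) => ⋂ i ∈ I, A i = ∅) ⟨Finset.univ, by simpa using hAe⟩
  have hcard : k < I.card := by
    by_contra! hle
    rcases I.eq_empty_or_nonempty with rfl | ⟨i₀, hi₀⟩
    · simp at hI
    let e := I.equivFin
    -- If `I` had at most `k` indices, padding with `i₀` would list it by `Fin k`, against the
    -- failure of the Helly property.
    let j : Fin k → Fin m := fun l => if hl : (l : ℕ) < I.card then (e.symm ⟨l, hl⟩).1 else i₀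
    refine (hj j).ne_empty (Set.eq_empty_iff_forall_notMem.2 fun y hy => ?_)
    refine Set.eq_empty_iff_forall_notMem.1 hI y (Set.mem_iInter₂.2 fun i hi => ?_)
    have := Set.mem_iInter.1 hy ⟨e ⟨i, hi⟩, (e ⟨i, hi⟩).2.trans_le hle⟩
    simpa [j] using this
  refine ⟨I, inferInstance, fun i => C i, by simpa using hcard, fun i => hC i, fun y hy => ?_,
    fun i => ?_⟩
  · by_contra! hcon
    refine Set.eq_empty_iff_forall_notMem.1 hI y (Set.mem_iInter₂.2 fun i hi => ?_)
    rw [hAC]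
    exact ⟨hy, hcon ⟨i, hi⟩⟩
  · have hne : (⋂ j ∈ I.erase i, A j).Nonempty := by
      rw [Set.nonempty_iff_ne_empty]
      intro he
      exact Finset.notMem_erase _ _ (hImin he (Finset.erase_subset _ _) i.2)
    obtain ⟨y, hy⟩ := hne
    rw [Set.mem_iInter₂] at hy
    have hyS : ∀ j ∈ I.erase i, y ∈ S ∧ y ∈ C j := fun j hj => by
      have := hy j hj
      rwa [hAC] at this
    -- Since `1 ≤ k < I.card`, some index survives the erasure; without one, `y` need not lie in
    -- `S`.
    obtain ⟨j, hj⟩ : (I.erase i).Nonempty := by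
      rw [← Finset.card_pos, Finset.card_erase_of_mem i.2]
      omega
    exact ⟨y, (hyS j hj).1, fun l hl =>
      (hyS l (Finset.mem_erase.2 ⟨fun h => hl (Subtype.ext h), l.2⟩)).2⟩

lemma IsDiscreteSet.hasHellyProperty_of_isFacetBound (hd : 1 ≤ d) {S : Set 𝔼}
    (hS : IsDiscreteSet S) {k : ℕ} (hk1 : 1 ≤ k) (hk : IsFacetBound S k) :
    HasHellyProperty {A | IsSConvex S A} k := by
  have : Nonempty (Fin d) := ⟨⟨0, hd⟩⟩
  by_contra hcon
  obtain ⟨ι, _, C, hcard, hC⟩ := exists_isCritical_of_not_hasHellyProperty hk1 hcon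
  have : Nonempty ι := Fintype.card_pos_iff.1 (by omega)
  obtain ⟨x, u, hxS, hu, hux, hconv⟩ := hC.exists_points hS
  obtain ⟨L, hL, hfull, hle⟩ := hS.exists_isMaximalSFree_card_le_numFacets hxS hu hux hconv
  have := hle.trans (hk L hL hfull).2
  exact hcard.not_ge (by exact_mod_cast this)

theorem IsDiscreteSet.hellyNumber_le_facetComplexity (hd : 1 ≤ d) {S : Set 𝔼}
    (hS : IsDiscreteSet S) : (hellyNumber S : WithBot ℕ∞) ≤ facetComplexity S := by
  have hex : ∃ L, IsMaximalSFree S L ∧ IsFullDimensional L := by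
    rcases S.eq_empty_or_nonempty with rfl | hne
    · exact ⟨Set.univ, isMaximalSFree_empty_iff.2 rfl, by simp [IsFullDimensional]⟩
    · obtain ⟨L, h1, h2, -⟩ := hS.exists_isMaximalSFree_of_nonempty hd hne
      exact ⟨L, h1, h2⟩
  unfold facetComplexity
  rw [if_pos hex, WithBot.coe_le_coe]
  unfold hellyNumber familyHellyNumber
  split_ifs with h
  · exact bot_le
  rw [setOf_isSConvex_eq_singleton_empty_iff, ← ne_eq, ← Set.nonempty_iff_ne_empty] at h
  refine le_iInf₂ fun k hk => ?_
  have hk1 : 1 ≤ k := by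
    obtain ⟨L, h1, h2, h3⟩ := hS.exists_isMaximalSFree_of_nonempty hd h
    exact_mod_cast h3.trans (hk L h1 h2).2
  exact iInf₂_le k ⟨hk1, hS.hasHellyProperty_of_isFacetBound hd hk1 hk⟩

end SFree

theorem theorem1 (d : ℕ) (hd : 1 ≤ d) (S : Set (EuclideanSpace ℝ (Fin d))) :
    SFree.facetComplexity S ≤ (SFree.hellyNumber S : WithBot ℕ∞) ∧
      (SFree.IsDiscreteSet S →
        SFree.facetComplexity S = (SFree.hellyNumber S : WithBot ℕ∞)) :=
  ⟨SFree.facetComplexity_le_hellyNumber S, fun hS =>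
    (SFree.facetComplexity_le_hellyNumber S).antisymm (hS.hellyNumber_le_facetComplexity hd)⟩
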